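/- Let $q$ be a prime power, let $n\ge 2$ and $\lceil n/2\rceil\le r\le n-1$ be integers with $\gcd(n,r)=1$, and if $n=2$ assume that $q$ is odd. Put $T_n(z)=z+z^q+\cdots+z^{q^{n-1}}$, let $f_r(x)\in\mathbb F_{q^n}[x]$ be the remainder of $T_n(x^{1+q^r})$ on division by $x^{q^n}-x$, and let $\mathcal X_{n,r}$ be the plane curve $T_n(y)=f_r(x)$ over $\mathbb F_{q^n}$. Let $u(x)=x^{q^{n-r}+1}-x^{q^n+q^{n-r}}$. Then $\mathcal X_{n,r}$ has the plane model $$T_n(y)=x^{q^{n-r}+1}-x^{q^n+q^{n-r}},$$ that is, the polynomials $T_n(y)-f_r(x)$ and $T_n(y)-u(x)$ are irreducible over an algebraic closure of $\mathbb F_{q^n}$, and the function fields over $\mathbb F_{q^n}$ of the two plane curves that they define are isomorphic over $\mathbb F_{q^n}$. More precisely, let $x,y$ be the coordinate functions in the function field $F_{n,r}=\mathbb F_{q^n}(x,y)$ of $\mathcal X_{n,r}$, put $z_0=y^{q^{n-r}}-x^{q^{n-r}+1}$, let $\alpha,\beta$ be any positive integers with $(n-r)\alpha-\beta n=1$, and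 put $$w=-\sum_{i=0}^{\alpha-1}z_0^{\,q^{(n-r)i}}-\sum_{i=1}^{\beta}u(x)^{q^{n(\beta-i)+1}}.$$ Then there is a constant $a\in\mathbb F_{q^n}$ such that $\tilde w=w-a$ satisfies $T_n(\tilde w)=u(x)$, and there is an $\mathbb F_{q^n}$-isomorphism from the function field of the curve $T_n(y)=u(x)$ onto $F_{n,r}$ that sends the coordinate functions $x,y$ to $x,\tilde w$. -/

import Mathlib

open Polynomial

/-- The additive trace polynomial `T_n(z) = z + z^q + ⋯ + z^{q^{n-1}}` evaluated at `z`. -/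
def traceT {A : Type*} [CommRing A] (q n : ℕ) (z : A) : A :=
  ∑ i ∈ Finset.range n, z ^ q ^ i

/-- `f_r(x)`: the remainder of `T_n(x^{1+q^r})` on division by `x^{q^n} - x`. -/
noncomputable def fPoly (K : Type*) [Field K] (q n r : ℕ) : K[X] :=
  traceT q n ((X : K[X]) ^ (1 + q ^ r)) %ₘ ((X : K[X]) ^ q ^ n - X)

/-- `u(x) = x^{q^{n-r}+1} - x^{q^n+q^{n-r}}`, for `x` in any commutative ring. -/
def uFun {A : Type*} [CommRing A] (q n r : ℕ) (x : A) : A :=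
  x ^ (q ^ (n - r) + 1) - x ^ (q ^ n + q ^ (n - r))

/-- The equation `T_n(y) - f_r(x)` of the curve `X_{n,r}`, as an element of `K[x][y]`. -/
noncomputable def curveX (K : Type*) [Field K] (q n r : ℕ) : K[X][X] :=
  traceT q n (X : K[X][X]) - C (fPoly K q n r)

/-- The equation `T_n(y) - (x^{q^{n-r}+1} - x^{q^n+q^{n-r}})`, as an element of `K[x][y]`. -/
noncomputable def newModel (K : Type*) [Field K] (q n r : ℕ) : K[X][X] :=
  traceT q n (X : K[X][X]) - C (uFun q n r (X : K[X]))

/-- The plane affine curve `P(x,y) = 0` is geometrically irreducible: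
`P` is irreducible as a polynomial over an algebraic closure of `K`. -/
def GeomIrreducible {K : Type*} [Field K] (P : K[X][X]) : Prop :=
  Irreducible (P.map (mapRingHom (algebraMap K (AlgebraicClosure K))))

/-- The function field `K(x,y)` of the plane curve `P(x,y) = 0`: the fraction ring of the
coordinate ring `K[x,y]/(P)` (a field whenever `P` is irreducible). -/
abbrev FunField {K : Type*} [Field K] (P : K[X][X]) : Type _ :=
  FractionRing (AdjoinRoot P)

/-- The coordinate function `x` in the function field of `P(x,y) = 0`. -/
noncomputable def xFun {K : Type*} [Field K] (P : K[X][X]) : FunField P :=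
  algebraMap (AdjoinRoot P) (FunField P) (AdjoinRoot.of P X)

/-- The coordinate function `y` in the function field of `P(x,y) = 0`. -/
noncomputable def yFun {K : Type*} [Field K] (P : K[X][X]) : FunField P :=
  algebraMap (AdjoinRoot P) (FunField P) (AdjoinRoot.root P)

/-- `Q(x,y) = 0` is a plane model over `K` of the geometrically irreducible curve `P(x,y) = 0`:
it is geometrically irreducible as well and its function field is `K`-isomorphic to that of the
curve `P(x,y) = 0`, i.e. the two curves are birationally equivalent over `K`. -/
def IsPlaneModel {K : Type*} [Field K] (P Q : K[X][X]) : Prop :=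
  GeomIrreducible P ∧ GeomIrreducible Q ∧ Nonempty (FunField Q ≃ₐ[K] FunField P)

/-- `z₀ = y^{q^{n-r}} - x^{q^{n-r}+1}` in the function field of `X_{n,r}`. -/
noncomputable def zZero (K : Type*) [Field K] (q n r : ℕ) : FunField (curveX K q n r) :=
  yFun (curveX K q n r) ^ q ^ (n - r) - xFun (curveX K q n r) ^ (q ^ (n - r) + 1)

/-- `w = - ∑_{i=0}^{α-1} z₀^{q^{(n-r)i}} - ∑_{i=1}^{β} u(x)^{q^{n(β-i)+1}}`
in the function field of `X_{n,r}`. -/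
noncomputable def wFun (K : Type*) [Field K] (q n r α β : ℕ) : FunField (curveX K q n r) :=
  -(∑ i ∈ Finset.range α, zZero K q n r ^ q ^ ((n - r) * i))
    - ∑ i ∈ Finset.Icc 1 β, uFun q n r (xFun (curveX K q n r)) ^ q ^ (n * (β - i) + 1)

/-! ### Trace polynomials in characteristic `p` and the change of coordinates. -/

section TraceIdentities

variable {A : Type*} [CommRing A]

/-! Write `s = n - r`. Raising `f_r` to the power `q^s` gives `T_n(x^(q^s+1)) - T_s(u)`
(`fFun_pow`), so on the curve `T_n(z₀) = -T_s(u)`. Since `sα = βn + 1`, the additive polynomials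
`T_s` and `T_n` satisfy a Bézout identity, and applying it to this relation shows that `w` solves
both `T_n(w) = u` and `T_s(w) = -z₀`. Conversely `y = (y - y^(q^n)) + (y^(q^s))^(q^r)`, where the
bracket equals `f_r - f_r^q` and `y^(q^s) = x^(q^s+1) - T_s(w)`. Thus `y` is a polynomial in `x` and
`w`, the coordinate rings themselves are isomorphic, and `a = 0` works.

For irreducibility, suppose `T_n(Y) - g` is reducible. The Galois group then translates a root by a
proper subgroup of the kernel of `T_n`, and trace duality turns this into `t^p - t = c g` with `c ≠
0` (`exists_pow_sub_eq_mul`). Comparing coefficients excludes this for `g = u` when `n ≠ 2r`.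
Otherwise `n = 2`, `r = 1`, and `f_r = 2x^(q+1)` with `q` odd is used instead. The ring isomorphism
carries irreducibility to the other curve. -/

/-- The explicit form of `f_r(x)`, for `x` in any commutative ring. -/
def fFun (q n r : ℕ) (x : A) : A :=
  ∑ i ∈ Finset.range (n - r), x ^ (q ^ i + q ^ (i + r))
    + ∑ j ∈ Finset.range r, x ^ (q ^ (j + (n - r)) + q ^ j)

/-- The expression `y^{q^{n-r}} - x^{q^{n-r}+1}` in any commutative ring. -/
def zExpr (q n r : ℕ) (x y : A) : A := y ^ q ^ (n - r) - x ^ (q ^ (n - r) + 1)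

/-- The expression of the second coordinate of the new model in terms of `x` and `y`. -/
def wExpr (q n r α β : ℕ) (x y : A) : A :=
  -(∑ i ∈ Finset.range α, zExpr q n r x y ^ q ^ ((n - r) * i))
    - ∑ i ∈ Finset.Icc 1 β, uFun q n r x ^ q ^ (n * (β - i) + 1)

/-- The expression of the second coordinate of the original curve in terms of `x` and `w`. -/
def yExpr (q n r : ℕ) (x w : A) : A :=
  fFun q n r x - fFun q n r x ^ q + (x ^ (q ^ (n - r) + 1) - traceT q (n - r) w) ^ q ^ r

section Map

variable {B : Type*} [CommRing B] (φ : A →+* B)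

theorem map_traceT (q n : ℕ) (z : A) : φ (traceT q n z) = traceT q n (φ z) := by
  simp [traceT]

theorem map_uFun (q n r : ℕ) (x : A) : φ (uFun q n r x) = uFun q n r (φ x) := by
  simp [uFun]

theorem map_fFun (q n r : ℕ) (x : A) : φ (fFun q n r x) = fFun q n r (φ x) := by
  simp [fFun]

theorem map_wExpr (q n r α β : ℕ) (x y : A) :
    φ (wExpr q n r α β x y) = wExpr q n r α β (φ x) (φ y) := by
  simp [wExpr, zExpr, map_uFun]

theorem map_yExpr (q n r : ℕ) (x w : A) :
    φ (yExpr q n r x w) = yExpr q n r (φ x) (φ w) := by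
  simp [yExpr, map_fFun, map_traceT]

end Map

theorem traceT_add_index (q a b : ℕ) (z : A) :
    traceT q (a + b) z = traceT q a z + traceT q b (z ^ q ^ a) := by
  simp only [traceT, Finset.sum_range_add, ← pow_mul, ← pow_add]

theorem traceT_one (q : ℕ) (z : A) : traceT q 1 z = z := by simp [traceT]

variable {p m : ℕ} [Fact p.Prime] [CharP A p]

theorem exists_frobenius_pow (i : ℕ) :
    ∃ φ : A →+* A, ∀ a, φ a = a ^ (p ^ m) ^ i :=
  ⟨iterateFrobenius A p (m * i), fun a => by rw [iterateFrobenius_def, pow_mul]⟩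

theorem traceT_pow (n i : ℕ) (z : A) :
    traceT (p ^ m) n (z ^ (p ^ m) ^ i) = traceT (p ^ m) n z ^ (p ^ m) ^ i := by
  obtain ⟨φ, hφ⟩ := exists_frobenius_pow (A := A) (p := p) (m := m) i
  rw [← hφ, ← hφ, map_traceT]

variable (A p m) in
theorem exists_traceT_hom (n : ℕ) :
    ∃ τ : A →+ A, ∀ a, τ a = traceT (p ^ m) n a :=
  ⟨∑ i ∈ Finset.range n, (iterateFrobenius A p (m * i)).toAddMonoidHom, fun a => by
    simp [traceT, AddMonoidHom.finsetSum_apply, iterateFrobenius_def, pow_mul]⟩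

theorem sum_traceT_pow (a b : ℕ) (z : A) :
    ∑ i ∈ Finset.range b, traceT (p ^ m) a z ^ (p ^ m) ^ (a * i) = traceT (p ^ m) (a * b) z := by
  induction b with
  | zero => simp [traceT]
  | succ b ih => rw [Finset.sum_range_succ, ih, mul_add_one, traceT_add_index, traceT_pow]

/-- Telescoping: both ways of splitting `T_{n+1}(z)` are compared. -/
theorem sub_pow_eq_traceT (n : ℕ) (z : A) :
    z - z ^ (p ^ m) ^ n = traceT (p ^ m) n z - traceT (p ^ m) n z ^ (p ^ m) := by
  have h1 := traceT_add_index (p ^ m) n 1 z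
  have h2 := traceT_add_index (p ^ m) 1 n z
  rw [traceT_one] at h1 h2
  rw [traceT_pow, pow_one, add_comm 1 n, h1] at h2
  linear_combination -h2

theorem sum_Icc_sub (β n : ℕ) (f : ℕ → A) :
    ∑ i ∈ Finset.Icc 1 β, f (n * (β - i) + 1) = ∑ i ∈ Finset.range β, f (n * i + 1) := by
  refine Finset.sum_bij' (fun i _ => β - i) (fun j _ => β - j) ?_ ?_ ?_ ?_ ?_ <;>
    simp <;> omega

theorem neg_pow_pow (i : ℕ) (z : A) : (-z) ^ (p ^ m) ^ i = -z ^ (p ^ m) ^ i := by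
  obtain ⟨φ, hφ⟩ := exists_frobenius_pow (A := A) (p := p) (m := m) i
  rw [← hφ, ← hφ, map_neg]

theorem traceT_comm (a b : ℕ) (z : A) :
    traceT (p ^ m) a (traceT (p ^ m) b z) = traceT (p ^ m) b (traceT (p ^ m) a z) := by
  obtain ⟨τ, hτ⟩ := exists_traceT_hom A p m a
  rw [← hτ, traceT, map_sum]
  simp only [hτ, traceT_pow]
  rfl

/-- A Bézout identity for the trace polynomials of coprime lengths `s` and `n`. -/
theorem sum_traceT_sub_sum_traceT {s n α β : ℕ} (h : s * α = β * n + 1) (v : A) :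
    ∑ i ∈ Finset.range α, traceT (p ^ m) s v ^ (p ^ m) ^ (s * i)
      - ∑ i ∈ Finset.Icc 1 β, traceT (p ^ m) n v ^ (p ^ m) ^ (n * (β - i) + 1) = v := by
  -- The first sum is `T_{sα}(v) = T_{βn+1}(v)` and the second is `T_{βn}(v^q)`; they differ by the
  -- leading term `v`.
  rw [sum_Icc_sub β n (fun j => traceT (p ^ m) n v ^ (p ^ m) ^ j), sum_traceT_pow, h]
  have : ∑ i ∈ Finset.range β, traceT (p ^ m) n v ^ (p ^ m) ^ (n * i + 1) =
      traceT (p ^ m) (n * β) (v ^ (p ^ m) ^ 1) := by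
    rw [← sum_traceT_pow]
    refine Finset.sum_congr rfl fun i _ => ?_
    rw [traceT_pow, ← pow_mul (traceT (p ^ m) n v), ← pow_add, add_comm 1]
  rw [this, add_comm, traceT_add_index, traceT_one, mul_comm β n]
  ring

/-- With `s = n - r`, the second sum of `fFun`, raised to `q^s`, supplies the terms of
`T_n(x^(q^s+1))` of index at least `s`. The missing terms and the first sum together make up
`-T_s(u)`. -/
theorem fFun_pow {n r : ℕ} (hrn : r ≤ n) (x : A) :
    fFun (p ^ m) n r x ^ (p ^ m) ^ (n - r) =
      traceT (p ^ m) n (x ^ ((p ^ m) ^ (n - r) + 1))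
        - traceT (p ^ m) (n - r) (uFun (p ^ m) n r x) := by
  obtain ⟨s, rfl⟩ := Nat.exists_eq_add_of_le hrn
  rw [Nat.add_sub_cancel_left]
  set q := p ^ m with hq
  obtain ⟨τ, hτ⟩ := exists_traceT_hom A p m s
  obtain ⟨φ, hφ⟩ := exists_frobenius_pow (A := A) (p := p) (m := m) s
  have key : traceT q (r + s) (x ^ (q ^ s + 1)) = traceT q s (x ^ (q ^ s + 1))
      + ∑ j ∈ Finset.range r, (x ^ (q ^ (j + s) + q ^ j)) ^ q ^ s := by
    rw [add_comm r s, traceT_add_index]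
    congr 1
    refine Finset.sum_congr rfl fun j _ => ?_
    simp only [← pow_mul]
    congr 1
    ring
  rw [key, ← hφ, fFun, map_add, map_sum, map_sum, Nat.add_sub_cancel_left, uFun, ← hτ, ← hτ,
    map_sub, Nat.add_sub_cancel_left]
  have : τ (x ^ (q ^ (r + s) + q ^ s)) =
      ∑ i ∈ Finset.range s, φ (x ^ (q ^ i + q ^ (i + r))) := by
    rw [hτ, traceT]
    refine Finset.sum_congr rfl fun i _ => ?_
    rw [hφ, ← hq, ← pow_mul x, ← pow_mul x]
    ring_nf
  rw [this]
  simp only [hφ]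
  ring

section Coordinates

variable {n r : ℕ} {x y w : A}

theorem traceT_zExpr (hrn : r ≤ n) (hy : traceT (p ^ m) n y = fFun (p ^ m) n r x) :
    traceT (p ^ m) n (zExpr (p ^ m) n r x y) =
      -traceT (p ^ m) (n - r) (uFun (p ^ m) n r x) := by
  obtain ⟨τ, hτ⟩ := exists_traceT_hom A p m n
  rw [zExpr, ← hτ, map_sub, hτ, hτ, traceT_pow, hy, fFun_pow hrn]
  ring

/-- Substituting `T_s(u) = -T_n(z)` turns `T_s(w)` into minus the Bézout combination of `z`. Dually,
`traceT_wExpr` substitutes `T_n(z) = -T_s(u)` and obtains the combination of `u`. -/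
theorem traceT_wExpr_sub {α β : ℕ} (hαβ : (n - r) * α = β * n + 1) (hrn : r ≤ n)
    (hy : traceT (p ^ m) n y = fFun (p ^ m) n r x) :
    traceT (p ^ m) (n - r) (wExpr (p ^ m) n r α β x y) = -zExpr (p ^ m) n r x y := by
  obtain ⟨τ, hτ⟩ := exists_traceT_hom A p m (n - r)
  have hu : traceT (p ^ m) (n - r) (uFun (p ^ m) n r x) =
    -traceT (p ^ m) n (zExpr (p ^ m) n r x y) := by rw [traceT_zExpr hrn hy, neg_neg]
  rw [← sum_traceT_sub_sum_traceT hαβ (zExpr (p ^ m) n r x y), ← hτ, wExpr, map_sub, map_neg,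
    map_sum, map_sum]
  simp only [hτ, traceT_pow, hu, neg_pow_pow, Finset.sum_neg_distrib]
  ring

theorem traceT_wExpr {α β : ℕ} (hαβ : (n - r) * α = β * n + 1) (hrn : r ≤ n)
    (hy : traceT (p ^ m) n y = fFun (p ^ m) n r x) :
    traceT (p ^ m) n (wExpr (p ^ m) n r α β x y) = uFun (p ^ m) n r x := by
  obtain ⟨τ, hτ⟩ := exists_traceT_hom A p m n
  refine Eq.trans ?_ (sum_traceT_sub_sum_traceT (m := m) hαβ (uFun (p ^ m) n r x))
  rw [← hτ, wExpr, map_sub, map_neg, map_sum, map_sum]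
  simp only [hτ, traceT_pow, traceT_zExpr hrn hy, neg_pow_pow, Finset.sum_neg_distrib, neg_neg]

theorem yExpr_wExpr {α β : ℕ} (hαβ : (n - r) * α = β * n + 1) (hrn : r ≤ n)
    (hy : traceT (p ^ m) n y = fFun (p ^ m) n r x) :
    yExpr (p ^ m) n r x (wExpr (p ^ m) n r α β x y) = y := by
  rw [yExpr, traceT_wExpr_sub hαβ hrn hy, zExpr, sub_neg_eq_add, add_sub_cancel, ← pow_mul,
    ← pow_add, Nat.sub_add_cancel hrn, ← hy, ← sub_pow_eq_traceT]
  ring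

theorem traceT_sub_traceT (hrn : r ≤ n) (hw : traceT (p ^ m) n w = uFun (p ^ m) n r x) :
    traceT (p ^ m) n (x ^ ((p ^ m) ^ (n - r) + 1) - traceT (p ^ m) (n - r) w) =
      fFun (p ^ m) n r x ^ (p ^ m) ^ (n - r) := by
  obtain ⟨τ, hτ⟩ := exists_traceT_hom A p m n
  rw [fFun_pow hrn, ← hτ, map_sub, hτ, hτ, traceT_comm, hw]

/-- Put `A = x^(q^s+1) - T_s(w)`. As `T_n(A) = f^(q^s)`, telescoping gives `A - A^(q^n) = (f -
f^q)^(q^s)`, which is what `yExpr` adds to `A^(q^r)` before the power is taken. -/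
theorem yExpr_pow (hrn : r ≤ n) (hw : traceT (p ^ m) n w = uFun (p ^ m) n r x) :
    yExpr (p ^ m) n r x w ^ (p ^ m) ^ (n - r) =
      x ^ ((p ^ m) ^ (n - r) + 1) - traceT (p ^ m) (n - r) w := by
  obtain ⟨φ, hφ⟩ := exists_frobenius_pow (A := A) (p := p) (m := m) (n - r)
  have h := traceT_sub_traceT hrn hw
  have h' := sub_pow_eq_traceT (p := p) (m := m) n
    (x ^ ((p ^ m) ^ (n - r) + 1) - traceT (p ^ m) (n - r) w)
  rw [h] at h'
  rw [yExpr, ← hφ, map_add, map_sub, hφ, hφ, hφ, ← pow_mul _ ((p ^ m) ^ r), ← pow_add,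
    Nat.add_sub_cancel' hrn, pow_right_comm]
  linear_combination -h'

theorem traceT_yExpr (hrn : r ≤ n) (hw : traceT (p ^ m) n w = uFun (p ^ m) n r x) :
    traceT (p ^ m) n (yExpr (p ^ m) n r x w) = fFun (p ^ m) n r x := by
  obtain ⟨τ, hτ⟩ := exists_traceT_hom A p m n
  have h := traceT_sub_traceT hrn hw
  have h' := sub_pow_eq_traceT (p := p) (m := m) n (fFun (p ^ m) n r x)
  have h1 := traceT_pow (p := p) (m := m) n 1 (fFun (p ^ m) n r x)
  rw [pow_one] at h1
  rw [yExpr, ← hτ, map_add, map_sub, hτ, hτ, hτ, traceT_pow, h, ← pow_mul, ← pow_add,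
    Nat.sub_add_cancel hrn, h1]
  linear_combination -h'

theorem wExpr_yExpr {α β : ℕ} (hαβ : (n - r) * α = β * n + 1) (hrn : r ≤ n)
    (hw : traceT (p ^ m) n w = uFun (p ^ m) n r x) :
    wExpr (p ^ m) n r α β x (yExpr (p ^ m) n r x w) = w := by
  refine Eq.trans ?_ (sum_traceT_sub_sum_traceT (m := m) hαβ w)
  have hz : zExpr (p ^ m) n r x (yExpr (p ^ m) n r x w) = -traceT (p ^ m) (n - r) w := by
    rw [zExpr, yExpr_pow hrn hw]
    ring
  simp only [wExpr, hz, hw, neg_pow_pow, Finset.sum_neg_distrib, neg_neg]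

end Coordinates

end TraceIdentities

/-! ### Coordinate rings of curves `T_n(y) = g(x)`, and the remainder `f_r`. -/

section TraceCurve

theorem irreducible_iff_isDomain_adjoinRoot {R : Type*} [CommRing R] [IsDomain R]
    [UniqueFactorizationMonoid R] {P : R[X]} (hP : P ≠ 0) :
    Irreducible P ↔ IsDomain (AdjoinRoot P) := by
  rw [irreducible_iff_prime, ← Ideal.span_singleton_prime hP]
  exact (Ideal.Quotient.isDomain_iff_prime _).symm

variable {L : Type*} [Field L]

theorem traceT_X_sub_C {R : Type*} [CommRing R] [Nontrivial R] {q n : ℕ} (hq : 2 ≤ q)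
    (hn : 1 ≤ n) (g : R) :
    (traceT q n (X : R[X]) - C g).Monic ∧
      (traceT q n (X : R[X]) - C g).natDegree = q ^ (n - 1) := by
  obtain ⟨k, rfl⟩ := Nat.exists_eq_add_of_le' hn
  have h0 : 0 < q ^ k := pow_pos (by omega) k
  have hlt : (traceT q k (X : R[X]) - C g).degree < (X ^ q ^ k : R[X]).degree := by
    rw [degree_X_pow]
    refine (degree_sub_le _ _).trans_lt (max_lt ?_ ?_)
    · refine (degree_sum_le _ _).trans_lt ((Finset.sup_lt_iff (WithBot.bot_lt_coe _)).2 ?_)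
      intro i hi
      rw [degree_X_pow]
      exact_mod_cast Nat.pow_lt_pow_right hq (Finset.mem_range.1 hi)
    · exact degree_C_le.trans_lt (by exact_mod_cast h0)
  have heq : traceT q (k + 1) (X : R[X]) - C g = X ^ q ^ k + (traceT q k (X : R[X]) - C g) := by
    rw [traceT, Finset.sum_range_succ, ← traceT]
    ring
  rw [heq]
  refine ⟨(monic_X_pow _).add_of_left hlt, ?_⟩
  rw [natDegree_add_eq_left_of_degree_lt hlt, natDegree_X_pow, Nat.add_sub_cancel]

theorem traceT_root {R : Type*} [CommRing R] (q n : ℕ) (g : R) :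
    traceT q n (AdjoinRoot.root (traceT q n (X : R[X]) - C g)) =
      AdjoinRoot.of (traceT q n (X : R[X]) - C g) g := by
  have h := AdjoinRoot.mk_self (f := traceT q n (X : R[X]) - C g)
  rwa [map_sub, map_traceT, AdjoinRoot.mk_X, AdjoinRoot.mk_C, sub_eq_zero] at h

theorem eval₂_traceT_X_sub_C {R S : Type*} [CommRing R] [CommRing S] (i : R →+* S) (q n : ℕ)
    (g : R) (z : S) :
    eval₂ i z (traceT q n (X : R[X]) - C g) = traceT q n z - i g := by
  simp [traceT, eval₂_finsetSum]

theorem map_traceT_X_sub_C {R S : Type*} [CommRing R] [CommRing S] (i : R →+* S) (q n : ℕ)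
    (g : R) : (traceT q n (X : R[X]) - C g).map i = traceT q n X - C (i g) := by
  simp [traceT, Polynomial.map_sum]

theorem charP_adjoinRoot {q n p : ℕ} [CharP L p] (hq : 2 ≤ q) (hn : 1 ≤ n) (g : L[X]) :
    CharP (AdjoinRoot (traceT q n (X : L[X][X]) - C g)) p := by
  obtain ⟨h1, h2⟩ := traceT_X_sub_C hq hn g
  have : Nontrivial (AdjoinRoot (traceT q n (X : L[X][X]) - C g)) := by
    refine AdjoinRoot.nontrivial _ ?_
    rw [degree_eq_natDegree h1.ne_zero, h2]
    exact_mod_cast (pow_pos (by omega : 0 < q) _).ne'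
  exact charP_of_injective_algebraMap (algebraMap L _).injective p

/-- The coordinate rings of the two plane curves are isomorphic, by mutually inverse
polynomial maps. -/
theorem exists_coordinateRing_equiv {p m n r α β : ℕ} [Fact p.Prime] [CharP L p] (hm : m ≠ 0)
    (hn : 1 ≤ n) (hrn : r ≤ n) (hαβ : (n - r) * α = β * n + 1) {f : L[X]}
    (hf : f = fFun (p ^ m) n r X) :
    ∃ e : AdjoinRoot (newModel L (p ^ m) n r) ≃ₐ[L[X]]
        AdjoinRoot (traceT (p ^ m) n (X : L[X][X]) - C f),
      e (AdjoinRoot.root _) =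
        wExpr (p ^ m) n r α β (AdjoinRoot.of _ X) (AdjoinRoot.root _) := by
  have hq : 2 ≤ p ^ m := (Fact.out : p.Prime).two_le.trans (Nat.le_self_pow hm p)
  set P := traceT (p ^ m) n (X : L[X][X]) - C f with hP
  set Q := newModel L (p ^ m) n r with hQ
  have : CharP (AdjoinRoot P) p := charP_adjoinRoot hq hn f
  have : CharP (AdjoinRoot Q) p := charP_adjoinRoot hq hn (uFun (p ^ m) n r X)
  have hy : traceT (p ^ m) n (AdjoinRoot.root P) = fFun (p ^ m) n r (AdjoinRoot.of P X) := by
    rw [hP, traceT_root, ← map_fFun, ← hf]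
  have hw : traceT (p ^ m) n (AdjoinRoot.root Q) = uFun (p ^ m) n r (AdjoinRoot.of Q X) := by
    rw [hQ, newModel, traceT_root, ← map_uFun]
  have h1 : eval₂ (algebraMap L[X] (AdjoinRoot P))
      (wExpr (p ^ m) n r α β (AdjoinRoot.of P X) (AdjoinRoot.root P)) Q = 0 := by
    rw [hQ, newModel, eval₂_traceT_X_sub_C, traceT_wExpr hαβ hrn hy, map_uFun, sub_eq_zero]
    rfl
  have h2 : eval₂ (algebraMap L[X] (AdjoinRoot Q))
      (yExpr (p ^ m) n r (AdjoinRoot.of Q X) (AdjoinRoot.root Q)) P = 0 := by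
    rw [hP, eval₂_traceT_X_sub_C, traceT_yExpr hrn hw, hf, map_fFun, sub_eq_zero]
    rfl
  let Ψ : AdjoinRoot Q →ₐ[L[X]] AdjoinRoot P := AdjoinRoot.liftAlgHom Q (Algebra.ofId _ _) _ h1
  let Φ : AdjoinRoot P →ₐ[L[X]] AdjoinRoot Q := AdjoinRoot.liftAlgHom P (Algebra.ofId _ _) _ h2
  have hΨ : Ψ (AdjoinRoot.root Q) =
      wExpr (p ^ m) n r α β (AdjoinRoot.of P X) (AdjoinRoot.root P) :=
    AdjoinRoot.lift_root h1
  have hΦ : Φ (AdjoinRoot.root P) =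
      yExpr (p ^ m) n r (AdjoinRoot.of Q X) (AdjoinRoot.root Q) :=
    AdjoinRoot.lift_root h2
  have hΨx : Ψ (AdjoinRoot.of Q X) = AdjoinRoot.of P X := Ψ.commutes X
  have hΦx : Φ (AdjoinRoot.of P X) = AdjoinRoot.of Q X := Φ.commutes X
  refine ⟨AlgEquiv.ofAlgHom Ψ Φ ?_ ?_, hΨ⟩
  · refine AdjoinRoot.algHom_ext ?_
    rw [AlgHom.comp_apply, hΦ, AlgHom.id_apply]
    refine (map_yExpr Ψ.toRingHom _ _ _ _ _).trans ?_
    refine Eq.trans ?_ (yExpr_wExpr hαβ hrn hy)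
    exact congrArg₂ _ hΨx hΨ
  · refine AdjoinRoot.algHom_ext ?_
    rw [AlgHom.comp_apply, hΨ, AlgHom.id_apply]
    refine (map_wExpr Φ.toRingHom _ _ _ _ _ _ _).trans ?_
    refine Eq.trans ?_ (wExpr_yExpr hαβ hrn hw)
    exact congrArg₂ _ hΦx hΦ

theorem fPoly_eq_fFun {q n r : ℕ} (hq : 2 ≤ q) (hr : 1 ≤ r) (hrn : r < n) :
    fPoly L q n r = fFun q n r X := by
  have hqn : 1 < q ^ n := Nat.one_lt_pow (by omega) hq
  have hlt : (X : L[X]).degree < (X ^ q ^ n : L[X]).degree := by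
    rw [degree_X, degree_X_pow]; exact_mod_cast hqn
  have hmon : ((X : L[X]) ^ q ^ n - X).Monic := (monic_X_pow _).sub_of_left hlt
  have hdeg : ((X : L[X]) ^ q ^ n - X).degree = ((q ^ n : ℕ) : WithBot ℕ) := by
    rw [degree_sub_eq_left_of_degree_lt hlt, degree_X_pow]
  -- Every exponent in `fFun` is a sum of two distinct powers of `q` below `q^n`, so `fFun` is
  -- already reduced.
  have hbound : ∀ a b : ℕ, a < n → b < n → a ≠ b → q ^ a + q ^ b < q ^ n := by
    intro a b ha hb hab
    wlog h : a < b generalizing a b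
    · rw [add_comm]; exact this b a hb ha hab.symm (by omega)
    calc q ^ a + q ^ b < q ^ b + q ^ b := by gcongr
      _ = 2 * q ^ b := by ring
      _ ≤ q * q ^ b := by gcongr
      _ = q ^ (b + 1) := by ring
      _ ≤ q ^ n := Nat.pow_le_pow_right (by omega) (by omega)
  have hd : (fFun q n r (X : L[X])).degree < ((X : L[X]) ^ q ^ n - X).degree := by
    rw [hdeg]
    refine (degree_add_le _ _).trans_lt (max_lt ?_ ?_) <;>
    · refine (degree_sum_le _ _).trans_lt ((Finset.sup_lt_iff (WithBot.bot_lt_coe _)).2 ?_)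
      intro i hi
      rw [degree_X_pow]
      have := Finset.mem_range.1 hi
      exact_mod_cast hbound _ _ (by omega) (by omega) (by omega)
  refine (modByMonic_eq_of_dvd_sub hmon ?_).trans ((modByMonic_eq_self_iff hmon).2 hd)
  -- The terms of index `j + (n - r)` contain `x^(q^(n+j))`, which reduces to `x^(q^j)`.
  have hsum : traceT q n ((X : L[X]) ^ (1 + q ^ r)) - fFun q n r X =
      ∑ j ∈ Finset.range r, X ^ q ^ (j + (n - r)) * ((X ^ q ^ n) ^ q ^ j - X ^ q ^ j) := by
    obtain ⟨s, rfl⟩ := Nat.exists_eq_add_of_le hrn.le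
    rw [Nat.add_sub_cancel_left, fFun, Nat.add_sub_cancel_left, add_comm r s, traceT,
      Finset.sum_range_add]
    simp only [mul_sub, Finset.sum_sub_distrib, ← pow_mul, ← pow_add]
    have h1 : ∀ i, (1 + q ^ r) * q ^ i = q ^ i + q ^ (i + r) := fun i => by ring
    simp only [h1]
    rw [add_sub_add_left_eq_sub]
    congr 1
    refine Finset.sum_congr rfl fun i _ => ?_
    ring_nf
  rw [hsum]
  exact Finset.dvd_sum fun j _ => (sub_dvd_pow_sub_pow _ _ _).mul_left _

end TraceCurve

/-! ### Obstruction to `t^p - t`, and duality for the trace form. -/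

section Irreducibility

theorem coeff_pow_char {L : Type*} [Field L] {p : ℕ} [Fact p.Prime] [CharP L p] (t : L[X])
    (N : ℕ) : (t ^ p).coeff N = if p ∣ N then t.coeff (N / p) ^ p else 0 := by
  rw [← map_frobenius_expand p t, coeff_map, coeff_expand (Fact.out : p.Prime).pos]
  split_ifs <;> simp [frobenius_def, (Fact.out : p.Prime).ne_zero]

/-- A polynomial with an isolated nonzero coefficient of degree prime to `p` is not of the form
`t ^ p - t`, even up to a nonzero constant. -/
theorem pow_char_sub_self_ne {L : Type*} [Field L] {p N : ℕ} [Fact p.Prime] [CharP L p]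
    (hN : ¬p ∣ N) {g : L[X]} (h0 : g.coeff N ≠ 0) (h : ∀ j, g.coeff (N * p ^ (j + 1)) = 0)
    {c : L} (hc : c ≠ 0) (t : L[X]) : t ^ p - t ≠ C c * g := by
  intro ht
  have hp : p.Prime := Fact.out
  -- The nonzero coefficient at `N` propagates to every `N p^j`, which no polynomial can sustain.
  have hne : ∀ j, t.coeff (N * p ^ j) ≠ 0 := by
    intro j
    induction j with
    | zero =>
      have := congrArg (coeff · N) ht
      simp only [coeff_sub, coeff_pow_char, if_neg hN, coeff_C_mul, zero_sub] at this
      rw [pow_zero, mul_one, ← neg_ne_zero, this]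
      exact mul_ne_zero hc h0
    | succ j ih =>
      have := congrArg (coeff · (N * p ^ (j + 1))) ht
      have hdvd : p ∣ N * p ^ (j + 1) := (dvd_pow_self p j.succ_ne_zero).mul_left N
      have hdiv : N * p ^ (j + 1) / p = N * p ^ j := by
        rw [pow_succ, ← mul_assoc, Nat.mul_div_cancel _ hp.pos]
      simp only [coeff_sub, coeff_pow_char, if_pos hdvd, hdiv, coeff_C_mul, h, mul_zero,
        sub_eq_zero] at this
      rw [← this]
      exact pow_ne_zero _ ih
  refine hne t.natDegree.succ (coeff_eq_zero_of_natDegree_lt ?_)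
  have hNpos : 0 < N := Nat.pos_of_ne_zero fun h => hN (h ▸ dvd_zero p)
  calc t.natDegree < t.natDegree.succ := Nat.lt_succ_self _
    _ < p ^ t.natDegree.succ := Nat.lt_pow_self hp.one_lt
    _ ≤ N * p ^ t.natDegree.succ := Nat.le_mul_of_pos_left _ hNpos

theorem mem_range_algebraMap_of_pow_card_eq {K E : Type*} [Field K] [Finite K] [Field E]
    [Algebra K E] {d : E} (hd : d ^ Nat.card K = d) : ∃ a : K, algebraMap K E a = d := by
  have hs := Polynomial.splits_X_pow_nat_card_sub_X (K := K)
  have hne : (X ^ Nat.card K - X : K[X]) ≠ 0 :=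
    FiniteField.X_pow_card_sub_X_ne_zero K Finite.one_lt_card
  have hd' : d ∈ ((X ^ Nat.card K - X : K[X]).map (algebraMap K E)).roots := by
    rw [mem_roots (map_ne_zero hne)]
    simp [hd]
  rw [hs.roots_map] at hd'
  obtain ⟨a, -, ha⟩ := Multiset.mem_map.1 hd'
  exact ⟨a, ha⟩

theorem traceT_mul_index {A : Type*} [CommRing A] {p : ℕ} [Fact p.Prime] [CharP A p] (m n : ℕ)
    (z : A) : traceT p (m * n) z = traceT p m (traceT (p ^ m) n z) := by
  obtain ⟨τ, hτ⟩ := exists_traceT_hom A p 1 m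
  simp only [pow_one] at hτ
  induction n with
  | zero => rw [← hτ]; simp [traceT]
  | succ n ih => rw [mul_add_one, traceT_add_index, traceT_add_index, traceT_one, ← hτ (_ + _),
      map_add, hτ, hτ, ih, ← pow_mul p]

/-- Duality for the trace form of a finite field: a proper additive subgroup of the kernel of
`T_n` is separated from it by a character `v ↦ Tr(c v)` with `c` outside the field of order `q`. -/
theorem exists_trace_eq_zero_of_notMem {K : Type*} [Field K] [Finite K] {p m n : ℕ}
    [Fact p.Prime] [CharP K p] (hK : Nat.card K = (p ^ m) ^ n) (G : AddSubgroup K) {v : K}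
    (hv : v ∉ G) (hT : traceT (p ^ m) n v = 0) :
    ∃ c : K, (∀ a ∈ G, traceT p (m * n) (c * a) = 0) ∧ c ^ p ^ m ≠ c := by
  let : Algebra (ZMod p) K := ZMod.algebra K p
  have hrank : Module.finrank (ZMod p) K = m * n := by
    have h := Module.natCard_eq_pow_finrank (K := ZMod p) (V := K)
    rw [hK, Nat.card_zmod, ← pow_mul] at h
    exact (Nat.pow_right_injective (Fact.out : p.Prime).two_le h).symm
  have htr (z : K) : algebraMap (ZMod p) K (Algebra.trace (ZMod p) K z) = traceT p (m * n) z := by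
    rw [FiniteField.algebraMap_trace_eq_sum_pow, hrank, Nat.card_zmod, traceT]
  obtain ⟨f, hfv, hfG⟩ := Submodule.exists_le_ker_of_notMem
    (p := AddSubgroup.toZModSubmodule p G) (v := v) hv
  let D := LinearMap.BilinForm.toDual _ (traceForm_nondegenerate (ZMod p) K)
  have hD (z : K) : Algebra.trace (ZMod p) K (D.symm f * z) = f z := by
    have := LinearMap.congr_fun (D.apply_symm_apply f) z
    rwa [LinearMap.BilinForm.toDual_def, Algebra.traceForm_apply] at this
  refine ⟨D.symm f, fun a ha => ?_, fun hc => hfv ?_⟩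
  · rw [← htr, hD, LinearMap.mem_ker.1 (hfG ha), map_zero]
  · apply (algebraMap (ZMod p) K).injective
    rw [← hD, htr, map_zero]
    -- If `c^q = c`, then `T_n(cv) = c T_n(v) = 0`; the absolute trace factors through `T_n`, so `f
    -- v` would vanish.
    set c := D.symm f
    have hci (i : ℕ) : c ^ (p ^ m) ^ i = c := by
      induction i with
      | zero => simp
      | succ i ih => rw [pow_succ, pow_mul, ih, hc]
    have hcv : traceT (p ^ m) n (c * v) = 0 := by
      rw [← mul_zero c, ← hT, traceT, traceT, Finset.mul_sum]
      simp only [mul_pow, hci]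
    rw [traceT_mul_index, hcv]
    simp [traceT, (Fact.out : p.Prime).ne_zero]

end Irreducibility

/-! ### Reducibility of `T_n(Y) - g` through Galois theory. -/

section ArtinSchreier

theorem pow_natCard_eq_self {K : Type*} [Field K] [Finite K] (a : K) : a ^ Nat.card K = a := by
  have := Fintype.ofFinite K
  rw [Nat.card_eq_fintype_card, FiniteField.pow_card]

theorem separable_traceT_X_sub_C {F : Type*} [Field F] {p m n : ℕ} [CharP F p] (hm : m ≠ 0) (hn : 1 ≤ n) (g : F) :
    (traceT (p ^ m) n (X : F[X]) - C g).Separable := by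
  have hder : derivative (traceT (p ^ m) n (X : F[X]) - C g) = 1 := by
    obtain ⟨k, rfl⟩ := Nat.exists_eq_add_of_le' hn
    rw [traceT, Finset.sum_range_succ']
    simp [derivative_X_pow, pow_succ, hm]
  rw [separable_def, hder]
  exact isCoprime_one_right

variable {K F : Type*} [Field K] [Finite K] [Field F] [Algebra K F] {p m n : ℕ} [Fact p.Prime]
  [CharP K p]

/-- An element with the same trace as `y` in an extension of a finite field `K` of order `q ^ n`
is a translate of `y` by an element of `K`. -/
theorem exists_add_algebraMap_of_traceT_eq {E : Type*} [Field E] [Algebra K E]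
    (hK : Nat.card K = (p ^ m) ^ n) {y y' : E}
    (h : traceT (p ^ m) n y' = traceT (p ^ m) n y) :
    ∃ a : K, traceT (p ^ m) n a = 0 ∧ y' = y + algebraMap K E a := by
  have : CharP E p := charP_of_injective_algebraMap (algebraMap K E).injective p
  have hd : traceT (p ^ m) n (y' - y) = 0 := by
    obtain ⟨τ, hτ⟩ := exists_traceT_hom E p m n
    rw [← hτ, map_sub, hτ, hτ, h, sub_self]
  have hfix := sub_pow_eq_traceT (p := p) (m := m) n (y' - y)
  rw [hd, zero_pow (pow_ne_zero _ (Fact.out : p.Prime).ne_zero), sub_zero, sub_eq_zero, ← hK]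
    at hfix
  obtain ⟨a, ha⟩ := mem_range_algebraMap_of_pow_card_eq hfix.symm
  refine ⟨a, (algebraMap K E).injective ?_, by rw [ha]; ring⟩
  rw [map_traceT, ha, hd, map_zero]

/-- The roots form a coset of the kernel of `T_n` in `K`. If Galois translations miss part of this
kernel, a `c` outside the field of order `q` has `Tr(ca) = 0` for every translation `a`, so `t =
Tr(cy)` is Galois-invariant, and telescoping computes `t^p - t`. -/
theorem exists_pow_sub_eq_mul_pow_sub (hm : m ≠ 0) (hn : 1 ≤ n)
    (hK : Nat.card K = (p ^ m) ^ n) {g : F}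
    (hirr : ¬Irreducible (traceT (p ^ m) n (X : F[X]) - C g)) :
    ∃ c : K, c ^ p ^ m ≠ c ∧ ∃ t : F, t ^ p - t = algebraMap K F c * (g ^ p ^ m - g) := by
  have hq : 2 ≤ p ^ m := (Fact.out : p.Prime).two_le.trans (Nat.le_self_pow hm p)
  have : CharP F p := charP_of_injective_algebraMap (algebraMap K F).injective p
  set P := traceT (p ^ m) n (X : F[X]) - C g
  obtain ⟨hmonic, hdeg⟩ : P.Monic ∧ P.natDegree = (p ^ m) ^ (n - 1) := traceT_X_sub_C hq hn g
  have hsep : P.Separable := separable_traceT_X_sub_C hm hn g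
  let E := P.SplittingField
  have : CharP E p := charP_of_injective_algebraMap (algebraMap F E).injective p
  have : IsGalois F E := IsGalois.of_separable_splitting_field hsep
  have hsplit : (P.map (algebraMap F E)).Splits := SplittingField.splits P
  have hroot (z : E) : aeval z P = 0 ↔ traceT (p ^ m) n z = algebraMap F E g := by
    have h : aeval z P = traceT (p ^ m) n z - algebraMap F E g :=
      eval₂_traceT_X_sub_C _ _ _ _ _
    rw [h, sub_eq_zero]
  have hcomm (σ : Gal(E/F)) (a : K) : σ (algebraMap K E a) = algebraMap K E a := by
    rw [IsScalarTower.algebraMap_apply K F E, σ.commutes]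
  obtain ⟨y, hy⟩ : ∃ y : E, aeval y P = 0 := by
    obtain ⟨y, hy⟩ := hsplit.exists_eval_eq_zero (by
      rw [degree_map, degree_eq_natDegree hmonic.ne_zero, hdeg]
      exact_mod_cast (pow_pos (by omega : 0 < p ^ m) _).ne')
    exact ⟨y, by rwa [← eval_map_algebraMap]⟩
  have hTy := (hroot y).1 hy
  let G : AddSubgroup K :=
    { carrier := {a | ∃ σ : Gal(E/F), σ y = y + algebraMap K E a}
      zero_mem' := ⟨1, by simp⟩
      add_mem' := by
        rintro a b ⟨σ, hσ⟩ ⟨τ, hτ⟩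
        exact ⟨σ * τ, by rw [AlgEquiv.mul_apply, hτ, map_add, hσ, hcomm, map_add, add_assoc]⟩
      neg_mem' := by
        rintro a ⟨σ, hσ⟩
        refine ⟨σ.symm, ?_⟩
        rw [AlgEquiv.symm_apply_eq, map_add, hσ, hcomm, map_neg]
        ring }
  by_cases hG : ∀ v : K, traceT (p ^ m) n v = 0 → v ∈ G
  · refine absurd ?_ hirr
    have hint : IsIntegral F y := ⟨P, hmonic, hy⟩
    obtain ⟨R, hR⟩ := minpoly.dvd F y hy
    -- A root of the cofactor `R` would be a conjugate of `y`, hence also a root of the minimal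
    -- polynomial, against separability.
    have hRdeg : R.degree = 0 := by
      by_contra hne
      have hRs : (R.map (algebraMap F E)).Splits :=
        hsplit.of_dvd (map_ne_zero hmonic.ne_zero)
          (map_dvd_map' (algebraMap F E) |>.2 (Dvd.intro_left _ hR.symm))
      obtain ⟨y', hy'⟩ := hRs.exists_eval_eq_zero (by rwa [degree_map])
      rw [eval_map_algebraMap] at hy'
      have hPy' : aeval y' P = 0 := 
        (congrArg (aeval y') hR).trans (by rw [map_mul, hy', mul_zero])
      obtain ⟨a, ha, rfl⟩ := exists_add_algebraMap_of_traceT_eq (p := p) (m := m) hK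
        (((hroot y').1 hPy').trans hTy.symm)
      obtain ⟨σ, hσ⟩ := hG a ha
      have hM : aeval (y + algebraMap K E a) (minpoly F y) = 0 := by
        rw [← hσ, aeval_algEquiv]
        simp
      rw [hR] at hsep
      obtain ⟨u, v, huv⟩ := hsep.isCoprime
      have := congrArg (aeval (y + algebraMap K E a)) huv
      simp [hM, hy'] at this
    rw [hR, irreducible_mul_isUnit (isUnit_iff_degree_eq_zero.2 hRdeg)]
    exact minpoly.irreducible hint
  · push Not at hG
    obtain ⟨v, hTv, hvG⟩ := hG
    obtain ⟨c, hcG, hc⟩ := exists_trace_eq_zero_of_notMem hK G hvG hTv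
    refine ⟨c, hc, ?_⟩
    obtain ⟨τ, hτ⟩ := exists_traceT_hom E p 1 (m * n)
    simp only [pow_one] at hτ
    have hfixed : ∀ σ : Gal(E/F), σ (traceT p (m * n) (algebraMap K E c * y)) =
        traceT p (m * n) (algebraMap K E c * y) := by
      intro σ
      have hσT : traceT (p ^ m) n (σ y) = traceT (p ^ m) n y := by
        have := map_traceT (σ : E →+* E) (p ^ m) n y
        rw [hTy] at this ⊢
        exact this.symm.trans (σ.commutes g)
      obtain ⟨a, -, ha⟩ := exists_add_algebraMap_of_traceT_eq (p := p) (m := m) hK hσT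
      refine (map_traceT (σ : E →+* E) p (m * n) _).trans ?_
      have h0 : traceT p (m * n) (algebraMap K E (c * a)) = 0 := by
        rw [← map_traceT, hcG a ⟨σ, ha⟩, map_zero]
      rw [map_mul]
      change traceT p (m * n) (σ _ * σ y) = _
      rw [hcomm, ha, mul_add, ← hτ, map_add, ← map_mul, hτ, hτ, h0, add_zero]
    obtain ⟨t, ht⟩ := IntermediateField.mem_bot.1 ((IsGalois.mem_bot_iff_fixed _).2 hfixed)
    refine ⟨t, (algebraMap F E).injective ?_⟩
    have h1 := sub_pow_eq_traceT (p := p) (m := 1) (m * n) (algebraMap K E c * y)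
    have h2 := sub_pow_eq_traceT (p := p) (m := m) n y
    have h3 : algebraMap K E c ^ (p ^ m) ^ n = algebraMap K E c := by
      rw [← map_pow, ← hK, pow_natCard_eq_self]
    rw [hTy] at h2
    rw [pow_one, ← ht, pow_mul p, mul_pow, h3] at h1
    rw [map_sub, map_pow, map_mul, map_sub, map_pow, ← IsScalarTower.algebraMap_apply K F E]
    linear_combination h1 - algebraMap K E c * h2

/-- If `T_n(Y) - g` is reducible, then `g` is, up to a nonzero constant, of the form
`t ^ p - t`. -/
theorem exists_pow_sub_eq_mul (hm : m ≠ 0) (hn : 1 ≤ n)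
    (hK : Nat.card K = (p ^ m) ^ n) {g : F}
    (hirr : ¬Irreducible (traceT (p ^ m) n (X : F[X]) - C g)) :
    ∃ c : K, c ≠ 0 ∧ ∃ t : F, t ^ p - t = algebraMap K F c * g := by
  have : CharP F p := charP_of_injective_algebraMap (algebraMap K F).injective p
  obtain ⟨c, hc, t, ht⟩ := exists_pow_sub_eq_mul_pow_sub hm hn hK hirr
  -- `d` is the `q`-th root of `c` in `K`. Hence `c g^q = (dg)^q` differs from `dg` by some `s^p -
  -- s`, which removes `g^q` and leaves the constant `d - c`.
  set d := c ^ (p ^ m) ^ (n - 1) with hd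
  have hdc : d ^ p ^ m = c := by
    rw [hd, ← pow_mul, ← pow_succ, Nat.sub_add_cancel hn, ← hK, pow_natCard_eq_self]
  refine ⟨d - c, fun h => hc ?_, t - traceT p m (algebraMap K F d * g), ?_⟩
  · rw [sub_eq_zero] at h
    rw [← h, hdc, h]
  · have h1 := sub_pow_eq_traceT (p := p) (m := 1) m (algebraMap K F d * g)
    rw [pow_one, mul_pow, ← map_pow, hdc] at h1
    rw [sub_pow_char, map_sub]
    linear_combination ht - h1

theorem irreducible_traceT_X_sub_C {L : Type*} [Field L] [Algebra K L] (hm : m ≠ 0) (hn : 1 ≤ n)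
    (hK : Nat.card K = (p ^ m) ^ n) {g : L[X]}
    (hg : ∀ c : L, c ≠ 0 → ∀ t : L[X], t ^ p - t ≠ C c * g) :
    Irreducible (traceT (p ^ m) n (X : L[X][X]) - C g) := by
  have hq : 2 ≤ p ^ m := (Fact.out : p.Prime).two_le.trans (Nat.le_self_pow hm p)
  rw [(traceT_X_sub_C hq hn g).1.irreducible_iff_irreducible_map_fraction_map
    (K := FractionRing L[X])]
  rw [map_traceT_X_sub_C]
  by_contra hirr
  obtain ⟨c, hc, t, ht⟩ := exists_pow_sub_eq_mul hm hn hK hirr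
  have hca : algebraMap K (FractionRing L[X]) c =
      algebraMap L[X] (FractionRing L[X]) (C (algebraMap K L c)) := by
    rw [IsScalarTower.algebraMap_apply K L[X] (FractionRing L[X])]
    rfl
  rw [hca, ← map_mul] at ht
  -- After Gauss's lemma `t` is only a rational function; its monic Artin–Schreier equation makes it
  -- a polynomial.
  have hint : IsIntegral L[X] t := by
    have hp : 1 < p := (Fact.out : p.Prime).one_lt
    refine ⟨X ^ p - X - C (C (algebraMap K L c) * g), ?_, by simp [ht]⟩
    rw [sub_sub]
    refine (monic_X_pow p).sub_of_left ?_
    rw [degree_X_pow]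
    refine (degree_X_add_C _).trans_lt ?_
    exact_mod_cast hp
  obtain ⟨s, rfl⟩ := IsIntegrallyClosed.isIntegral_iff.1 hint
  refine hg (algebraMap K L c) (by simpa using hc) s ?_
  apply IsFractionRing.injective L[X] (FractionRing L[X])
  rw [map_sub, map_pow, ht]

end ArtinSchreier

/-! ### Irreducibility of the two curves, and the main theorem. -/

section PlaneModel

theorem not_dvd_pow_add_one {p k : ℕ} (hp : p.Prime) (hk : k ≠ 0) : ¬p ∣ p ^ k + 1 := by
  rw [Nat.dvd_add_right (dvd_pow_self p hk)]
  exact hp.one_lt.ne' ∘ Nat.dvd_one.1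

theorem eq_of_mul_pow_eq_mul_pow {p a b i j : ℕ} (hp : p.Prime) (ha : ¬p ∣ a)
    (hb : ¬p ∣ b) (h : a * p ^ i = b * p ^ j) : a = b := by
  have hij : i = j := by
    have hf := congrArg (fun N => padicValNat p N) h
    have : Fact p.Prime := ⟨hp⟩
    have ha0 : a ≠ 0 := fun h => ha (h ▸ dvd_zero p)
    have hb0 : b ≠ 0 := fun h => hb (h ▸ dvd_zero p)
    simpa [padicValNat.mul, ha0, hb0, hp.ne_zero, padicValNat.eq_zero_of_not_dvd ha,
      padicValNat.eq_zero_of_not_dvd hb] using hf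
  subst hij
  exact Nat.eq_of_mul_eq_mul_right (pow_pos hp.pos _) h

variable {L : Type*} [Field L] {p m n r : ℕ} [Fact p.Prime] [CharP L p]

/-- The exponents of `u` have prime-to-`p` parts `q^(n-r)+1` and `q^r+1`. These differ exactly when
`n ≠ 2r`, and then the second monomial cannot cancel the chain started by the first. -/
theorem pow_sub_self_ne_mul_uFun (hm : m ≠ 0) (hr : r ≠ 0) (hrn : r < n) (hne : n ≠ 2 * r)
    {c : L} (hc : c ≠ 0) (t : L[X]) : t ^ p - t ≠ C c * uFun (p ^ m) n r X := by
  have hp : p.Prime := Fact.out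
  obtain ⟨s, rfl⟩ := Nat.exists_eq_add_of_lt hrn
  have hs : r + s + 1 - r = s + 1 := by omega
  have hNs : ¬p ∣ p ^ (m * (s + 1)) + 1 := not_dvd_pow_add_one hp (by simp [hm])
  have hNr : ¬p ∣ p ^ (m * r) + 1 := not_dvd_pow_add_one hp (by simp [hm, hr])
  have hu : uFun (p ^ m) (r + s + 1) r (X : L[X]) =
      X ^ (p ^ (m * (s + 1)) + 1) - X ^ ((p ^ (m * r) + 1) * p ^ (m * (s + 1))) := by
    rw [uFun, hs]
    ring_nf
  have key : ∀ j, (p ^ (m * (s + 1)) + 1) * p ^ j ≠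
      (p ^ (m * r) + 1) * p ^ (m * (s + 1)) := by
    intro j hj
    have h1 := eq_of_mul_pow_eq_mul_pow hp hNs hNr hj
    have h2 := Nat.pow_right_injective hp.two_le (Nat.add_right_cancel h1)
    have h3 := Nat.eq_of_mul_eq_mul_left (Nat.pos_of_ne_zero hm) h2
    omega
  rw [hu]
  refine pow_char_sub_self_ne hNs ?_ (fun j => ?_) hc t
  · have := key 0
    rw [pow_zero, mul_one] at this
    simp [coeff_X_pow, this]
  · have h1 : (p ^ (m * (s + 1)) + 1) * p ^ (j + 1) ≠ p ^ (m * (s + 1)) + 1 := by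
      have h := Nat.one_lt_pow j.succ_ne_zero hp.one_lt
      exact (lt_mul_of_one_lt_right (Nat.succ_pos _) h).ne'
    simp only [coeff_sub, coeff_X_pow, if_neg h1, if_neg (key (j + 1)), sub_zero]

theorem pow_sub_self_ne_mul_fFun_two (hm : m ≠ 0) (hp2 : Odd p)
    {c : L} (hc : c ≠ 0) (t : L[X]) : t ^ p - t ≠ C c * fFun (p ^ m) 2 1 X := by
  have hp : p.Prime := Fact.out
  have hf : fFun (p ^ m) 2 1 (X : L[X]) = C 2 * X ^ (p ^ m + 1) := by
    rw [C_ofNat]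
    simp [fFun, add_comm]
    ring
  have h2 : (2 : L) ≠ 0 := by
    have : ((2 : ℕ) : L) ≠ 0 := by
      rw [Ne, CharP.cast_eq_zero_iff L p, Nat.prime_dvd_prime_iff_eq hp Nat.prime_two]
      rintro rfl
      exact absurd hp2 (by decide)
    exact_mod_cast this
  rw [hf]
  refine pow_char_sub_self_ne (not_dvd_pow_add_one hp hm) ?_ (fun j => ?_) hc t
  · simpa using h2
  · have h1 : (p ^ m + 1) * p ^ (j + 1) ≠ p ^ m + 1 := by
      have h := Nat.one_lt_pow j.succ_ne_zero hp.one_lt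
      exact (lt_mul_of_one_lt_right (Nat.succ_pos _) h).ne'
    rw [coeff_C_mul, coeff_X_pow, if_neg h1, mul_zero]

/-- Both plane curves are irreducible over every extension `L` of the field of order `q ^ n`. -/
theorem irreducible_traceT_sub_fFun_and_newModel {K : Type*} [Field K] [Finite K] [CharP K p]
    [Algebra K L] (hm : m ≠ 0) (hn : 2 ≤ n) (hr : r ≠ 0) (hrn : r < n)
    (hcop : Nat.Coprime n r) (hdeg : n = 2 → Odd p) (hK : Nat.card K = (p ^ m) ^ n)
    {α β : ℕ} (hαβ : (n - r) * α = β * n + 1) :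
    Irreducible (traceT (p ^ m) n (X : L[X][X]) - C (fFun (p ^ m) n r X)) ∧
      Irreducible (newModel L (p ^ m) n r) := by
  have hq : 2 ≤ p ^ m := (Fact.out : p.Prime).two_le.trans (Nat.le_self_pow hm p)
  obtain ⟨e, -⟩ := exists_coordinateRing_equiv (L := L) hm (by omega) hrn.le hαβ rfl
  have hiff : Irreducible (traceT (p ^ m) n (X : L[X][X]) - C (fFun (p ^ m) n r X)) ↔
      Irreducible (newModel L (p ^ m) n r) := by
    rw [irreducible_iff_isDomain_adjoinRoot (traceT_X_sub_C hq (by omega) _).1.ne_zero,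
      irreducible_iff_isDomain_adjoinRoot
        (P := newModel L (p ^ m) n r) (traceT_X_sub_C hq (by omega) _).1.ne_zero]
    exact ⟨fun _ => e.toMulEquiv.isDomain _, fun _ => e.symm.toMulEquiv.isDomain _⟩
  -- For `n = 2r` the second monomial of `u` is the `q^r`-th power of the first, so the coefficient
  -- argument fails for `u`; coprimality leaves only `r = 1`.
  by_cases hne : n = 2 * r
  · have hr1 : r = 1 := by
      have h : r ∣ 1 := hcop ▸ Nat.dvd_gcd (hne ▸ Nat.dvd_mul_left r 2) dvd_rfl
      exact Nat.dvd_one.1 h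
    subst hr1
    obtain rfl : n = 2 := hne
    have h := irreducible_traceT_X_sub_C (L := L) hm (by omega) hK fun c hc t =>
      pow_sub_self_ne_mul_fFun_two hm (hdeg rfl) hc t
    exact ⟨h, hiff.1 h⟩
  · have h : Irreducible (newModel L (p ^ m) n r) :=
      irreducible_traceT_X_sub_C (L := L) hm (by omega) hK fun c hc t =>
        pow_sub_self_ne_mul_uFun hm hr hrn hne hc t
    exact ⟨hiff.2 h, h⟩

end PlaneModel

theorem mainTheorem4 (q n r : ℕ) (hq : IsPrimePow q) (hn : 2 ≤ n)
    (hnr : n ≤ 2 * r) (hrn : r < n) (hcop : Nat.Coprime n r)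
    (hdeg : n = 2 → Odd q)
    (K : Type*) [Field K] [Finite K] (hK : Nat.card K = q ^ n) :
    IsPlaneModel (curveX K q n r) (newModel K q n r) ∧
    ∀ α β : ℕ, 0 < α → 0 < β → (n - r) * α = β * n + 1 →
      ∃ a : K,
        traceT q n (wFun K q n r α β - algebraMap K (FunField (curveX K q n r)) a) =
          uFun q n r (xFun (curveX K q n r)) ∧
        ∃ φ : FunField (newModel K q n r) ≃ₐ[K] FunField (curveX K q n r),
          φ (xFun (newModel K q n r)) = xFun (curveX K q n r) ∧
          φ (yFun (newModel K q n r)) =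
            wFun K q n r α β - algebraMap K (FunField (curveX K q n r)) a := by
  obtain ⟨p, m, hp, hm, rfl⟩ := hq
  have : Fact p.Prime := ⟨hp.nat_prime⟩
  have hm : m ≠ 0 := hm.ne'
  have hr : r ≠ 0 := by omega
  have hq : 2 ≤ p ^ m := (Fact.out : p.Prime).two_le.trans (Nat.le_self_pow hm p)
  have : CharP K p := by
    have := Fintype.ofFinite K
    refine charP_of_card_eq_prime_pow (f := m * n) ?_
    rw [← Nat.card_eq_fintype_card, hK, pow_mul]
  have : CharP (AlgebraicClosure K) p :=
    charP_of_injective_algebraMap (algebraMap K (AlgebraicClosure K)).injective p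
  have hf : fPoly K (p ^ m) n r = fFun (p ^ m) n r X := fPoly_eq_fFun hq (by omega) hrn
  have main : ∀ α β : ℕ, (n - r) * α = β * n + 1 →
      traceT (p ^ m) n (wFun K (p ^ m) n r α β) =
        uFun (p ^ m) n r (xFun (curveX K (p ^ m) n r)) ∧
      ∃ φ : FunField (newModel K (p ^ m) n r) ≃ₐ[K] FunField (curveX K (p ^ m) n r),
        φ (xFun (newModel K (p ^ m) n r)) = xFun (curveX K (p ^ m) n r) ∧
        φ (yFun (newModel K (p ^ m) n r)) = wFun K (p ^ m) n r α β := by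
    intro α β hαβ
    obtain ⟨e, he⟩ := exists_coordinateRing_equiv hm (by omega) hrn.le hαβ hf
    change AdjoinRoot (newModel K (p ^ m) n r) ≃ₐ[K[X]] AdjoinRoot (curveX K (p ^ m) n r) at e
    let φ : FunField (newModel K (p ^ m) n r) ≃ₐ[K] FunField (curveX K (p ^ m) n r) :=
      IsFractionRing.algEquivOfAlgEquiv (e.restrictScalars K)
    have hφ (z) : φ (algebraMap _ _ z) = algebraMap _ _ (e z) :=
      IsFractionRing.algEquivOfAlgEquiv_algebraMap _ _
    have hφx : φ (xFun (newModel K (p ^ m) n r)) = xFun (curveX K (p ^ m) n r) :=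
      (hφ _).trans (congrArg _ (e.commutes X))
    have hφy : φ (yFun (newModel K (p ^ m) n r)) = wFun K (p ^ m) n r α β := by
      refine (hφ _).trans ((congrArg _ he).trans ?_)
      exact map_wExpr (algebraMap _ _) _ _ _ _ _ _ _
    refine ⟨?_, φ, hφx, hφy⟩
    have hT : traceT (p ^ m) n (yFun (newModel K (p ^ m) n r)) =
        uFun (p ^ m) n r (xFun (newModel K (p ^ m) n r)) := by
      rw [yFun, xFun, ← map_traceT, ← map_uFun, ← map_uFun]
      exact congrArg _ (traceT_root _ _ _)
    rw [← hφy, ← hφx]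
    exact (map_traceT (RingHomClass.toRingHom φ) _ _ _).symm.trans
      ((congrArg φ hT).trans (map_uFun (RingHomClass.toRingHom φ) _ _ _ _))
  obtain ⟨α, β, hαβ⟩ : ∃ α β, (n - r) * α = β * n + 1 := by
    have hs : (n - r).Coprime n := 
      ((Nat.coprime_self_sub_right hrn.le).2 hcop).symm
    obtain ⟨α, hα⟩ := Nat.exists_mul_mod_eq_one_of_coprime hs hn
    refine ⟨α, (n - r) * α / n, ?_⟩
    rw [mul_comm _ n, ← hα.2]
    exact (Nat.div_add_mod _ _).symm
  have hirr := irreducible_traceT_sub_fFun_and_newModel (L := AlgebraicClosure K) hm hn hr hrn hcop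
    (fun h => by simpa [Nat.odd_pow_iff hm] using hdeg h) hK hαβ
  -- The constant is `a = 0` for every admissible `α`, `β`.
  refine ⟨⟨?_, ?_, ⟨(main α β hαβ).2.choose⟩⟩, fun α β _ _ h => ⟨0, ?_⟩⟩
  · rw [GeomIrreducible, curveX, hf, map_traceT_X_sub_C, map_fFun, coe_mapRingHom, map_X]
    exact hirr.1
  · rw [GeomIrreducible, newModel, map_traceT_X_sub_C, map_uFun, coe_mapRingHom, map_X]
    exact hirr.2
  · simpa only [map_zero, sub_zero] using main α β h
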